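/- Let $n\ge 1$, let $U\subseteq\mathbb{R}^{n+1}$ be open with coordinates $(x^0,x^1,\dots,x^n)$, and let $g=(g_{ij})$ be a smooth Lorentzian metric on $U$ (signature $(-,+,\dots,+)$) in null coordinate form, i.e. $$g_{00}=0,\qquad g_{01}=g_{10}=1,\qquad g_{0i}=g_{i0}=0\quad (2\le i\le n),$$ the remaining components $g_{ij}$ $(1\le i,j\le n)$ being otherwise arbitrary smooth functions. On $\tilde U=\{x\in\mathbb{R}^{n+1} : (x^0,0,\dots,0)\in U\}$ let $$h_{PW}=2\,dx^0\,dx^1+\sum_{i,j=2}^n g_{ij}(x^0,0,\dots,0)\,dx^i\,dx^j$$ be the Penrose plane wave limit of $g$, i.e. the componentwise limit as $\varepsilon\to0^+$ of $\varepsilon^{-2}(\varphi_\varepsilon^{-1})^*g$, where $\varphi_\varepsilon(x)=(x^0,x^1/\varepsilon^2,x^2/\varepsilon,\dots,x^n/\varepsilon)$. Then $h_{PW}$ is a smooth Lorentzian metric on $\tilde U$, and: 1. If $g$ is Einstein on $U$, $\mathrm{Ric}=\lambda g$ for some constant $\lambda\in\mathbb{R}$, then $h_{PW}$ is Ricci-flat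 on $\tilde U$. 2. If $g$ is locally conformally flat on $U$ (each point has an open neighborhood on which $e^{2f}g$ has vanishing curvature tensor for some smooth function $f$), then so is $h_{PW}$ on $\tilde U$. 3. If $g$ is locally symmetric on $U$, $\nabla\mathrm{Rm}=0$, then so is $h_{PW}$ on $\tilde U$. 4. If $g$ has parallel Ricci tensor on $U$, $\nabla\mathrm{Ric}=0$, then so does $h_{PW}$ on $\tilde U$. -/

import Mathlib

open scoped ContDiff

/-! ## Metrics in a coordinate chart

A metric in local coordinates `(x⁰, …, xⁿ)` is the matrix-valued function `x ↦ (g_{ij}(x))`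
of its components.  Indices run over `Fin (n + 1)`. -/

noncomputable section

namespace NullLimit

variable {n : ℕ}

/-- Points of the coordinate space `ℝⁿ⁺¹`. -/
abbrev Coord (n : ℕ) : Type := Fin (n + 1) → ℝ

/-- The component matrix `(g_{ij})` of a field of bilinear forms on coordinate space. -/
abbrev MetricField (n : ℕ) : Type := Coord n → Matrix (Fin (n + 1)) (Fin (n + 1)) ℝ

/-- The coordinate partial derivative `∂ᵢ f`. -/
def pd (i : Fin (n + 1)) (f : Coord n → ℝ) (x : Coord n) : ℝ :=
  fderiv ℝ f x (Pi.single i 1)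

/-- The Minkowski matrix `diag(-1, 1, …, 1)`. -/
def minkowski (n : ℕ) : Matrix (Fin (n + 1)) (Fin (n + 1)) ℝ :=
  Matrix.diagonal fun i => if i = 0 then -1 else 1

/-- A Lorentzian scalar product: in some basis its matrix is `diag(-1, 1, …, 1)`.
(Symmetry of `A` follows.) -/
def IsLorentzianMatrix (A : Matrix (Fin (n + 1)) (Fin (n + 1)) ℝ) : Prop :=
  ∃ P : Matrix (Fin (n + 1)) (Fin (n + 1)) ℝ, IsUnit P.det ∧ P.transpose * A * P = minkowski n

/-- `g` is a smooth Lorentzian metric on `U`. -/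
structure IsLorentzianMetricOn (g : MetricField n) (U : Set (Coord n)) : Prop where
  smooth : ∀ i j, ContDiffOn ℝ ∞ (fun x => g x i j) U
  lorentzian : ∀ x ∈ U, IsLorentzianMatrix (g x)

/-! ### Levi-Civita connection and curvature -/

/-- `christoffel g k i j` is `Γᵏᵢⱼ = ½ gᵏˡ (∂ᵢ gⱼₗ + ∂ⱼ gᵢₗ - ∂ₗ gᵢⱼ)`. -/
def christoffel (g : MetricField n) (k i j : Fin (n + 1)) (x : Coord n) : ℝ :=
  (1 / 2) * ∑ l, (g x)⁻¹ k l *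
    (pd i (fun y => g y j l) x + pd j (fun y => g y i l) x - pd l (fun y => g y i j) x)

/-- The curvature endomorphism, `R(∂ᵢ, ∂ⱼ)∂ₖ = ∑ₗ (curvEndo g i j k l) ∂ₗ`, where
`R(X, Y)Z = ∇_X ∇_Y Z - ∇_Y ∇_X Z - ∇_[X,Y] Z`. -/
def curvEndo (g : MetricField n) (i j k l : Fin (n + 1)) (x : Coord n) : ℝ :=
  pd i (christoffel g l j k) x - pd j (christoffel g l i k) x
    + ∑ m, (christoffel g m j k x * christoffel g l i m x
        - christoffel g m i k x * christoffel g l j m x)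

/-- The curvature 4-tensor `Rmᵢⱼₖₗ = g(R(∂ᵢ, ∂ⱼ)∂ₖ, ∂ₗ)`. -/
def riem (g : MetricField n) (i j k l : Fin (n + 1)) (x : Coord n) : ℝ :=
  ∑ m, g x l m * curvEndo g i j k m x

/-- The Ricci tensor, `Ric(Y, Z) = tr (X ↦ R(X, Y)Z)`. -/
def ricci (g : MetricField n) (j k : Fin (n + 1)) (x : Coord n) : ℝ :=
  ∑ i, curvEndo g i j k i x

/-- The components `(∇ₚ Rm)ᵢⱼₖₗ`. -/
def covRiem (g : MetricField n) (p i j k l : Fin (n + 1)) (x : Coord n) : ℝ :=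
  pd p (riem g i j k l) x
    - ∑ m, (christoffel g m p i x * riem g m j k l x
        + christoffel g m p j x * riem g i m k l x
        + christoffel g m p k x * riem g i j m l x
        + christoffel g m p l x * riem g i j k m x)

/-- The components `(∇ₚ Ric)ᵢⱼ`. -/
def covRicci (g : MetricField n) (p i j : Fin (n + 1)) (x : Coord n) : ℝ :=
  pd p (ricci g i j) x
    - ∑ m, (christoffel g m p i x * ricci g m j x + christoffel g m p j x * ricci g i m x)

/-! ### Curvature conditions -/

/-- `Ric = lam g` on `U`. -/
def HasEinsteinConstantOn (g : MetricField n) (lam : ℝ) (U : Set (Coord n)) : Prop :=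
  ∀ x ∈ U, ∀ i j, ricci g i j x = lam * g x i j

/-- `Ric = 0` on `U`. -/
def IsRicciFlatOn (g : MetricField n) (U : Set (Coord n)) : Prop :=
  ∀ x ∈ U, ∀ i j, ricci g i j x = 0

/-- `Rm = 0` on `U`. -/
def IsFlatOn (g : MetricField n) (U : Set (Coord n)) : Prop :=
  ∀ x ∈ U, ∀ i j k l, riem g i j k l x = 0

/-- Every point of `U` has an open neighborhood on which some metric `e^{2f} g`, with `f` smooth,
is flat. -/
def IsLocallyConformallyFlatOn (g : MetricField n) (U : Set (Coord n)) : Prop :=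
  ∀ p ∈ U, ∃ V : Set (Coord n), IsOpen V ∧ p ∈ V ∧ V ⊆ U ∧
    ∃ f : Coord n → ℝ, ContDiffOn ℝ ∞ f V ∧
      IsFlatOn (fun x => Real.exp (2 * f x) • g x) V

/-- `∇ Rm = 0` on `U`. -/
def IsLocallySymmetricOn (g : MetricField n) (U : Set (Coord n)) : Prop :=
  ∀ x ∈ U, ∀ p i j k l, covRiem g p i j k l x = 0

/-- `∇ Ric = 0` on `U`. -/
def HasParallelRicciOn (g : MetricField n) (U : Set (Coord n)) : Prop :=
  ∀ x ∈ U, ∀ p i j, covRicci g p i j x = 0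

/-! ### Null coordinates and the plane wave limit -/

/-- The metric has null coordinate form on `U`: its first row is `(0, 1, 0, …, 0)` (hence, the
metric being symmetric, also its first column); the other components are arbitrary. -/
def IsNullFormOn (g : MetricField n) (U : Set (Coord n)) : Prop :=
  ∀ x ∈ U, ∀ j, g x 0 j = if j = 1 then 1 else 0

/-- The point `(x⁰, 0, …, 0)`. -/
def axisPoint (x : Coord n) : Coord n := Pi.single 0 (x 0)

/-- The plane wave limit `2 dx⁰ dx¹ + ∑_{i,j ≥ 2} g_{ij}(x⁰, 0, …, 0) dxⁱ dxʲ` of `g`. -/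
def planeWave (g : MetricField n) : MetricField n := fun x i j =>
  if (i = 0 ∧ j = 1) ∨ (i = 1 ∧ j = 0) then 1
  else if i = 0 ∨ i = 1 ∨ j = 0 ∨ j = 1 then 0
  else g (axisPoint x) i j

/-- The domain of the plane wave limit of a metric on `U`: the points `x` with
`(x⁰, 0, …, 0) ∈ U`. -/
def planeWaveDomain (U : Set (Coord n)) : Set (Coord n) := {x | axisPoint x ∈ U}

/-- The scaling weights `1, ε², ε, …, ε`. -/
def weight (ε : ℝ) (i : Fin (n + 1)) : ℝ := if i = 0 then 1 else if i = 1 then ε ^ 2 else ε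

/-- The inverse `(x⁰, ε² x¹, ε x², …, ε xⁿ)` of the map
`x ↦ (x⁰, x¹ / ε², x² / ε, …, xⁿ / ε)`. -/
def rescale (ε : ℝ) (x : Coord n) : Coord n := fun i => weight ε i * x i

/-- The components of the pullback `F* g`. -/
def pullback (F : Coord n → Coord n) (g : MetricField n) : MetricField n := fun x i j =>
  ∑ a, ∑ b, pd i (fun y => F y a) x * pd j (fun y => F y b) x * g (F x) a b

theorem pullback_rescale (ε : ℝ) (g : MetricField n) (x : Coord n) (i j : Fin (n + 1)) :
    pullback (rescale ε) g x i j = weight ε i * weight ε j * g (rescale ε x) i j := by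
  have key : ∀ i a : Fin (n + 1),
      pd i (fun y : Coord n => rescale ε y a) x = if a = i then weight ε i else 0 := by
    intro i a
    have h : HasFDerivAt (fun y : Coord n => rescale ε y a)
        (weight ε a • ContinuousLinearMap.proj (R := ℝ) (φ := fun _ : Fin (n + 1) => ℝ) a) x :=
      (ContinuousLinearMap.proj (R := ℝ) (φ := fun _ : Fin (n + 1) => ℝ) a).hasFDerivAt.const_mul
        (weight ε a)
    rw [pd, h.fderiv]
    by_cases hai : a = i
    · subst hai; simp
    · simp [hai]
  simp only [pullback, key, ite_mul, mul_ite, zero_mul, mul_zero, Finset.sum_ite_eq',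
    Finset.mem_univ, if_true]

/-- `planeWave g` is the pointwise limit, as `ε → 0⁺`, of the metrics `ε⁻² (φ_ε⁻¹)* g`, where
`φ_ε(x) = (x⁰, x¹ / ε², x² / ε, …, xⁿ / ε)`. -/
theorem tendsto_planeWave (hn : 1 ≤ n) {g : MetricField n} {U : Set (Coord n)} (hU : IsOpen U)
    (hg : ∀ i j, ContinuousOn (fun x => g x i j) U) (hsymm : ∀ x ∈ U, ∀ i j, g x i j = g x j i)
    (hnull : IsNullFormOn g U) {x : Coord n} (hx : x ∈ planeWaveDomain U) (i j : Fin (n + 1)) :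
    Filter.Tendsto (fun ε : ℝ => pullback (rescale ε) g x i j / ε ^ 2)
      (nhdsWithin 0 (Set.Ioi 0)) (nhds (planeWave g x i j)) := by
  have h10 : (1 : Fin (n + 1)) ≠ 0 := by
    obtain ⟨m, rfl⟩ := Nat.exists_eq_add_of_le' hn
    simp
  have hcont : Continuous fun ε : ℝ => rescale ε x := by
    refine continuous_pi fun a => ?_
    unfold rescale weight
    split_ifs <;> fun_prop
  have hr0 : rescale 0 x = axisPoint x := by
    funext a
    by_cases h0 : a = 0
    · subst h0; simp [rescale, weight, axisPoint]
    · by_cases h1 : a = 1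
      · subst h1; simp [rescale, weight, axisPoint, h0]
      · simp [rescale, weight, axisPoint, h0, h1]
  have hlim : Filter.Tendsto (fun ε : ℝ => rescale ε x) (nhdsWithin 0 (Set.Ioi 0))
      (nhds (axisPoint x)) := by
    have := hcont.tendsto 0
    rw [hr0] at this
    exact this.mono_left nhdsWithin_le_nhds
  have hmem : ∀ᶠ ε in nhdsWithin (0 : ℝ) (Set.Ioi 0), rescale ε x ∈ U :=
    hlim.eventually (hU.mem_nhds hx)
  have hgl : ∀ a b, Filter.Tendsto (fun ε : ℝ => g (rescale ε x) a b)
      (nhdsWithin 0 (Set.Ioi 0)) (nhds (g (axisPoint x) a b)) := fun a b =>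
    ((hg a b).continuousAt (hU.mem_nhds hx)).tendsto.comp hlim
  have hid : Filter.Tendsto (fun ε : ℝ => ε) (nhdsWithin 0 (Set.Ioi 0)) (nhds 0) :=
    Filter.tendsto_id.mono_left nhdsWithin_le_nhds
  have hpos : ∀ᶠ ε in nhdsWithin (0 : ℝ) (Set.Ioi 0), 0 < ε := self_mem_nhdsWithin
  have hrow : ∀ b : Fin (n + 1), ∀ᶠ ε in nhdsWithin (0 : ℝ) (Set.Ioi 0),
      weight ε (0 : Fin (n + 1)) * weight ε b * g (rescale ε x) 0 b / ε ^ 2 = if b = 1 then 1 else 0 := by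
    intro b
    filter_upwards [hmem, hpos] with ε h1 h2
    rw [hnull _ h1]
    by_cases hb : b = 1
    · subst hb; simp [weight, h10, h2.ne']
    · simp [hb]
  simp only [pullback_rescale]
  by_cases hi0 : i = 0
  · subst hi0
    refine (tendsto_const_nhds (x := planeWave g x 0 j)).congr' ?_
    filter_upwards [hrow j] with ε h
    rw [h]
    simp [planeWave, h10.symm]
  by_cases hj0 : j = 0
  · subst hj0
    refine (tendsto_const_nhds (x := planeWave g x i 0)).congr' ?_
    filter_upwards [hrow i, hmem] with ε h h2
    rw [hsymm _ h2, mul_comm (weight ε i), h]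
    simp [planeWave, h10.symm, hi0]
  by_cases hi1 : i = 1
  · subst hi1
    by_cases hj1 : j = 1
    · subst hj1
      have := (hid.pow 2).mul (hgl 1 1)
      simp only [planeWave, h10, and_false, false_and, or_self, or_true, true_or, if_true,
        if_false]
      rw [zero_pow two_ne_zero, zero_mul] at this
      refine this.congr' ?_
      filter_upwards [hpos] with ε h
      simp only [weight, h10, if_true, if_false]
      field_simp
    · have := hid.mul (hgl 1 j)
      simp only [planeWave, h10, hj0, hj1, and_false, false_and, or_self, or_true, true_or,
        if_true, if_false]
      rw [zero_mul] at this
      refine this.congr' ?_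
      filter_upwards [hpos] with ε h
      simp only [weight, h10, hj0, hj1, if_true, if_false]
      field_simp
  · by_cases hj1 : j = 1
    · subst hj1
      have := hid.mul (hgl i 1)
      simp only [planeWave, h10, hi0, hi1, and_false, false_and, or_self, or_true,
        if_true, if_false]
      rw [zero_mul] at this
      refine this.congr' ?_
      filter_upwards [hpos] with ε h
      simp only [weight, h10, hi0, hi1, if_true, if_false]
      field_simp
    · simp only [planeWave, hi0, hj0, hi1, hj1, and_false, or_self, if_false]
      refine (hgl i j).congr' ?_
      filter_upwards [hpos] with ε h
      simp only [weight, hi0, hj0, hi1, hj1, if_false]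
      field_simp

end NullLimit

end

open scoped ContDiff

noncomputable section

namespace NullLimit

variable {n : ℕ}

/-! ### Smooth one-parameter families -/

/-! For `ε ≠ 0` the metric `K_ε = ε⁻² (φ_ε⁻¹)* g` is, up to a constant factor, isometric to `g`, so
each tensor built from it is the corresponding tensor of `g` at the dilated point times nonzero
powers of `ε`. Conditions such as `∇Rm = 0` therefore pass from `g` to every `K_ε`.

The null form makes `K_ε` regular at `ε = 0`: the entry `g₀₁ = 1` absorbs `ε⁻²` exactly, the rest of
the first row and column vanishes, and every other entry carries a nonnegative power of `ε`. Thus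
`K_ε` is jointly smooth in `(ε, x)` with `K₀ = h_PW`. Since `h_PW` is itself nondegenerate
(`isLorentzianMatrix_planeWave`), inverses, and hence all curvature tensors, are also smooth across
`ε = 0`. An identity valid for `ε ≠ 0` then holds at `ε = 0` by continuity
(`SmoothFamilyOn.eq_zero_of_ne`).

Ricci is insensitive to constant factors, so `Ric = λ g` becomes `Ric(K_ε) = ε² λ K_ε`, whose limit
is `0`. In the conformally flat case the same argument runs on `e^{2f} g`; the conformal factor
tends to `e^{2f(x⁰, 0, …, 0)}`. -/

/-- The family `ε ↦ F ε` of functions on coordinate space is jointly smooth on `W`. -/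
def SmoothFamilyOn (F : ℝ → Coord n → ℝ) (W : Set (ℝ × Coord n)) : Prop :=
  ContDiffOn ℝ ∞ (fun q : ℝ × Coord n => F q.1 q.2) W

namespace SmoothFamilyOn

variable {F G : ℝ → Coord n → ℝ} {W : Set (ℝ × Coord n)}

theorem add (hF : SmoothFamilyOn F W) (hG : SmoothFamilyOn G W) :
    SmoothFamilyOn (fun ε x => F ε x + G ε x) W :=
  ContDiffOn.add hF hG

theorem sub (hF : SmoothFamilyOn F W) (hG : SmoothFamilyOn G W) :
    SmoothFamilyOn (fun ε x => F ε x - G ε x) W :=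
  ContDiffOn.sub hF hG

theorem mul (hF : SmoothFamilyOn F W) (hG : SmoothFamilyOn G W) :
    SmoothFamilyOn (fun ε x => F ε x * G ε x) W :=
  ContDiffOn.mul hF hG

theorem const (c : ℝ) : SmoothFamilyOn (fun _ (_ : Coord n) => c) W :=
  contDiffOn_const

theorem sum {ι : Type*} {s : Finset ι} {F : ι → ℝ → Coord n → ℝ}
    (hF : ∀ i, SmoothFamilyOn (F i) W) : SmoothFamilyOn (fun ε x => ∑ i ∈ s, F i ε x) W :=
  ContDiffOn.sum fun i _ => hF i

theorem prod {ι : Type*} {s : Finset ι} {F : ι → ℝ → Coord n → ℝ}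
    (hF : ∀ i, SmoothFamilyOn (F i) W) : SmoothFamilyOn (fun ε x => ∏ i ∈ s, F i ε x) W :=
  contDiffOn_prod fun i _ => hF i

/-- A partial derivative at fixed `ε` is the joint derivative applied to the vector `(0, eᵢ)`. -/
theorem pd (hW : IsOpen W) (hF : SmoothFamilyOn F W) (i : Fin (n + 1)) :
    SmoothFamilyOn (fun ε => pd i (F ε)) W := by
  have h1 : ContDiffOn ℝ ∞ (fderiv ℝ fun q : ℝ × Coord n => F q.1 q.2) W :=
    ContDiffOn.fderiv_of_isOpen hF hW (by simp)
  refine (h1.clm_apply (contDiffOn_const (c := ((0 : ℝ), Pi.single i (1 : ℝ))))).congr ?_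
  rintro ⟨ε, x⟩ hq
  have h2 : HasFDerivAt (fun q : ℝ × Coord n => F q.1 q.2) _ (ε, x) :=
    ((ContDiffOn.contDiffAt hF (hW.mem_nhds hq)).differentiableAt (by simp)).hasFDerivAt
  have h3 : HasFDerivAt (fun y : Coord n => (ε, y)) (ContinuousLinearMap.inr ℝ ℝ (Coord n)) x :=
    hasFDerivAt_prodMk_right ε x
  have h4 : HasFDerivAt (F ε) _ x := h2.comp x h3
  simp [NullLimit.pd, h4.fderiv]

/-- A family that vanishes for all nonzero parameters vanishes for the parameter `0`. -/
theorem eq_zero_of_ne (hW : IsOpen W) (hF : SmoothFamilyOn F W) {x : Coord n}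
    (hx : ((0 : ℝ), x) ∈ W) (h : ∀ ε : ℝ, ε ≠ 0 → (ε, x) ∈ W → F ε x = 0) : F 0 x = 0 := by
  have hc : ContinuousAt (fun ε : ℝ => F ε x) 0 :=
    ContinuousAt.comp (f := fun ε : ℝ => (ε, x)) (g := fun q : ℝ × Coord n => F q.1 q.2)
      (ContDiffOn.continuousOn hF |>.continuousAt (hW.mem_nhds hx)) (by fun_prop)
  have hmem : ∀ᶠ ε in nhdsWithin (0 : ℝ) {0}ᶜ, (ε, x) ∈ W :=
    ((show Continuous fun ε : ℝ => (ε, x) by fun_prop).continuousAt.eventually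
      (hW.mem_nhds hx)).filter_mono nhdsWithin_le_nhds
  -- Along the punctured neighborhood of `0` the family tends to `F 0 x` by continuity and is
  -- eventually the constant `0`.
  refine tendsto_nhds_unique (hc.tendsto.mono_left (nhdsWithin_le_nhds (s := {0}ᶜ)))
    (tendsto_const_nhds.congr' ?_)
  filter_upwards [hmem, self_mem_nhdsWithin] with ε h1 h2
  exact (h ε h2 h1).symm

end SmoothFamilyOn

/-! ### Joint smoothness of the curvature tensors of a family of metrics -/

section Tensors

variable {K : ℝ → MetricField n} {W : Set (ℝ × Coord n)}

theorem smoothFamilyOn_det {M : ℝ → MetricField n}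
    (hM : ∀ i j, SmoothFamilyOn (fun ε x => M ε x i j) W) :
    SmoothFamilyOn (fun ε x => (M ε x).det) W := by
  simp only [Matrix.det_apply']
  exact .sum fun σ => (SmoothFamilyOn.const _).mul (.prod fun i => hM _ _)

/-- Cramer's rule: the inverse is the adjugate over the determinant, and adjugate entries are
themselves determinants. -/
theorem smoothFamilyOn_inv (hK : ∀ i j, SmoothFamilyOn (fun ε x => K ε x i j) W)
    (hdet : ∀ q ∈ W, (K q.1 q.2).det ≠ 0) (i j : Fin (n + 1)) :
    SmoothFamilyOn (fun ε x => (K ε x)⁻¹ i j) W := by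
  have h1 : SmoothFamilyOn (fun ε x => ((K ε x).det)⁻¹) W :=
    ContDiffOn.inv (smoothFamilyOn_det hK) hdet
  have h2 : SmoothFamilyOn (fun ε x => (K ε x).adjugate i j) W := by
    simp only [Matrix.adjugate_apply]
    refine smoothFamilyOn_det (M := fun ε x => (K ε x).updateRow j (Pi.single i 1)) fun a b => ?_
    by_cases ha : a = j
    · subst ha
      simpa using SmoothFamilyOn.const _
    · simpa [Matrix.updateRow_ne ha] using hK a b
  simpa [Matrix.inv_def, Ring.inverse_eq_inv'] using h1.mul h2

theorem smoothFamilyOn_christoffel (hW : IsOpen W)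
    (hK : ∀ i j, SmoothFamilyOn (fun ε x => K ε x i j) W)
    (hdet : ∀ q ∈ W, (K q.1 q.2).det ≠ 0) (k i j : Fin (n + 1)) :
    SmoothFamilyOn (fun ε => christoffel (K ε) k i j) W :=
  (SmoothFamilyOn.const _).mul <| .sum fun l => (smoothFamilyOn_inv hK hdet k l).mul
    ((((hK j l).pd hW i).add ((hK i l).pd hW j)).sub ((hK i j).pd hW l))

theorem smoothFamilyOn_curvEndo (hW : IsOpen W)
    (hK : ∀ i j, SmoothFamilyOn (fun ε x => K ε x i j) W)
    (hdet : ∀ q ∈ W, (K q.1 q.2).det ≠ 0) (i j k l : Fin (n + 1)) :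
    SmoothFamilyOn (fun ε => curvEndo (K ε) i j k l) W := by
  have hΓ := smoothFamilyOn_christoffel hW hK hdet
  exact (((hΓ l j k).pd hW i).sub ((hΓ l i k).pd hW j)).add
    (.sum fun m => ((hΓ m j k).mul (hΓ l i m)).sub ((hΓ m i k).mul (hΓ l j m)))

theorem smoothFamilyOn_riem (hW : IsOpen W)
    (hK : ∀ i j, SmoothFamilyOn (fun ε x => K ε x i j) W)
    (hdet : ∀ q ∈ W, (K q.1 q.2).det ≠ 0) (i j k l : Fin (n + 1)) :
    SmoothFamilyOn (fun ε => riem (K ε) i j k l) W :=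
  .sum fun m => (hK l m).mul (smoothFamilyOn_curvEndo hW hK hdet i j k m)

theorem smoothFamilyOn_ricci (hW : IsOpen W)
    (hK : ∀ i j, SmoothFamilyOn (fun ε x => K ε x i j) W)
    (hdet : ∀ q ∈ W, (K q.1 q.2).det ≠ 0) (j k : Fin (n + 1)) :
    SmoothFamilyOn (fun ε => ricci (K ε) j k) W :=
  .sum fun i => smoothFamilyOn_curvEndo hW hK hdet i j k i

theorem smoothFamilyOn_covRiem (hW : IsOpen W)
    (hK : ∀ i j, SmoothFamilyOn (fun ε x => K ε x i j) W)
    (hdet : ∀ q ∈ W, (K q.1 q.2).det ≠ 0) (p i j k l : Fin (n + 1)) :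
    SmoothFamilyOn (fun ε => covRiem (K ε) p i j k l) W := by
  have hΓ := smoothFamilyOn_christoffel hW hK hdet
  have hR := smoothFamilyOn_riem hW hK hdet
  exact ((hR i j k l).pd hW p).sub (.sum fun m =>
    ((((hΓ m p i).mul (hR m j k l)).add ((hΓ m p j).mul (hR i m k l))).add
      ((hΓ m p k).mul (hR i j m l))).add ((hΓ m p l).mul (hR i j k m)))

theorem smoothFamilyOn_covRicci (hW : IsOpen W)
    (hK : ∀ i j, SmoothFamilyOn (fun ε x => K ε x i j) W)
    (hdet : ∀ q ∈ W, (K q.1 q.2).det ≠ 0) (p i j : Fin (n + 1)) :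
    SmoothFamilyOn (fun ε => covRicci (K ε) p i j) W := by
  have hΓ := smoothFamilyOn_christoffel hW hK hdet
  have hR := smoothFamilyOn_ricci hW hK hdet
  exact ((hR i j).pd hW p).sub (.sum fun m =>
    ((hΓ m p i).mul (hR m j)).add ((hΓ m p j).mul (hR i m)))

end Tensors

/-! ### Behaviour under anisotropic dilations -/

theorem weight_ne_zero {ε : ℝ} (hε : ε ≠ 0) (i : Fin (n + 1)) : weight ε i ≠ 0 := by
  unfold weight
  split_ifs <;> simp [hε]

theorem contDiff_rescale : ContDiff ℝ ∞ fun q : ℝ × Coord n => rescale q.1 q.2 := by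
  refine contDiff_pi.2 fun i => ?_
  unfold rescale weight
  split_ifs <;> fun_prop

theorem continuous_rescale (ε : ℝ) : Continuous (rescale ε : Coord n → Coord n) :=
  (contDiff_rescale (n := n)).continuous.comp (by fun_prop : Continuous fun x : Coord n => (ε, x))

theorem rescale_zero (x : Coord n) : rescale 0 x = axisPoint x := by
  funext a
  by_cases h0 : a = 0
  · subst h0; simp [rescale, weight, axisPoint]
  · by_cases h1 : a = 1
    · subst h1; simp [rescale, weight, axisPoint, h0]
    · simp [rescale, weight, axisPoint, h0, h1]

theorem contDiff_axisPoint : ContDiff ℝ ∞ (axisPoint : Coord n → Coord n) := by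
  have h : ContDiff ℝ ∞ fun x : Coord n => rescale 0 x :=
    contDiff_rescale.comp (contDiff_const.prodMk contDiff_id)
  simpa only [rescale_zero] using h

/-- A dilation with nonzero parameter as a linear isomorphism. -/
def rescaleEquiv {ε : ℝ} (hε : ε ≠ 0) : Coord n ≃L[ℝ] Coord n :=
  ContinuousLinearEquiv.piCongrRight fun i =>
    ContinuousLinearEquiv.unitsEquivAut ℝ (Units.mk0 (weight ε i) (weight_ne_zero hε i))

theorem coe_rescaleEquiv {ε : ℝ} (hε : ε ≠ 0) :
    (rescaleEquiv hε : Coord n → Coord n) = rescale ε := by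
  funext x i
  simp [rescaleEquiv, rescale, mul_comm]

section Scaling

variable {ε c : ℝ} {V : Set (Coord n)} {K G : MetricField n}

/-- The chain rule for dilations. -/
theorem pd_of_eq_comp_rescale (hε : ε ≠ 0) (hV : IsOpen V) {F f : Coord n → ℝ} {a : ℝ}
    (h : ∀ x, rescale ε x ∈ V → F x = a * f (rescale ε x)) (i : Fin (n + 1)) (x : Coord n)
    (hx : rescale ε x ∈ V) : pd i F x = a * weight ε i * pd i f (rescale ε x) := by
  have h1 : F =ᶠ[nhds x] a • (f ∘ rescaleEquiv hε) := by
    filter_upwards [(hV.preimage (continuous_rescale ε)).mem_nhds hx] with y hy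
    simpa [coe_rescaleEquiv] using h y hy
  -- Each basis vector is an eigenvector of the dilation, so the chain rule only produces a scalar
  -- weight.
  have h2 : rescaleEquiv hε (Pi.single i 1) = weight ε i • (Pi.single i 1 : Coord n) := by
    funext j
    rw [coe_rescaleEquiv]
    by_cases hj : j = i
    · subst hj; simp [rescale]
    · simp [hj, rescale]
  rw [pd, h1.fderiv_eq, fderiv_const_smul_field, Pi.smul_apply,
    ContinuousLinearEquiv.comp_right_fderiv]
  simp only [smul_apply, ContinuousLinearMap.comp_apply,
    ContinuousLinearEquiv.coe_coe, h2, map_smul, smul_eq_mul, pd, coe_rescaleEquiv]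
  ring

/-- `K` is the pullback of `G` under the dilation with parameter `ε`, times the constant `c`, over
the preimage of `V`. -/
def IsRescalingOn (ε c : ℝ) (K G : MetricField n) (V : Set (Coord n)) : Prop :=
  ∀ x, rescale ε x ∈ V → ∀ i j, K x i j = c * weight ε i * weight ε j * G (rescale ε x) i j

namespace IsRescalingOn

theorem eq_mul_mul (h : IsRescalingOn ε c K G V) {x : Coord n} (hx : rescale ε x ∈ V) :
    K x = Matrix.diagonal (fun i => c * weight ε i) * G (rescale ε x) *
      Matrix.diagonal (weight ε) := by
  ext i j
  rw [Matrix.mul_diagonal, Matrix.diagonal_mul, h x hx]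
  ring

theorem det_ne_zero (hε : ε ≠ 0) (hc : c ≠ 0) (h : IsRescalingOn ε c K G V) {x : Coord n}
    (hx : rescale ε x ∈ V) (hG : (G (rescale ε x)).det ≠ 0) : (K x).det ≠ 0 := by
  rw [h.eq_mul_mul hx, Matrix.det_mul, Matrix.det_mul, Matrix.det_diagonal, Matrix.det_diagonal]
  exact mul_ne_zero (mul_ne_zero (Finset.prod_ne_zero_iff.2 fun i _ =>
    mul_ne_zero hc (weight_ne_zero hε i)) hG) (Finset.prod_ne_zero_iff.2 fun i _ =>
      weight_ne_zero hε i)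

theorem inv_apply (hε : ε ≠ 0) (hc : c ≠ 0) (h : IsRescalingOn ε c K G V) {x : Coord n}
    (hx : rescale ε x ∈ V) (i j : Fin (n + 1)) :
    (K x)⁻¹ i j = (c * weight ε i * weight ε j)⁻¹ * (G (rescale ε x))⁻¹ i j := by
  have hw := weight_ne_zero (n := n) hε
  have hinv : ∀ v : Fin (n + 1) → ℝ, (∀ i, v i ≠ 0) →
      (Matrix.diagonal v)⁻¹ = Matrix.diagonal fun i => (v i)⁻¹ := fun v hv => by
    refine Matrix.inv_eq_left_inv ?_
    rw [Matrix.diagonal_mul_diagonal]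
    simp [hv]
  rw [h.eq_mul_mul hx, Matrix.mul_inv_rev, Matrix.mul_inv_rev, hinv _ hw,
    hinv _ fun i => mul_ne_zero hc (hw i), ← mul_assoc, Matrix.mul_diagonal, Matrix.diagonal_mul]
  have := hw i
  have := hw j
  field_simp

/-- The constant `c` cancels between the inverse metric and the differentiated metric. Lower indices
contribute weights and the upper index an inverse weight. -/
theorem christoffel (hε : ε ≠ 0) (hc : c ≠ 0) (hV : IsOpen V) (h : IsRescalingOn ε c K G V)
    (k i j : Fin (n + 1)) (x : Coord n) (hx : rescale ε x ∈ V) :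
    christoffel K k i j x =
      weight ε i * weight ε j * (weight ε k)⁻¹ * christoffel G k i j (rescale ε x) := by
  have hpd : ∀ p a b, pd p (fun y => K y a b) x =
      c * weight ε a * weight ε b * weight ε p * pd p (fun y => G y a b) (rescale ε x) :=
    fun p a b => pd_of_eq_comp_rescale hε hV (fun y hy => h y hy a b) p x hx
  unfold NullLimit.christoffel
  simp only [hpd, h.inv_apply hε hc hx]
  rw [Finset.mul_sum, Finset.mul_sum, Finset.mul_sum]
  refine Finset.sum_congr rfl fun l _ => ?_
  have := weight_ne_zero hε k
  have := weight_ne_zero hε l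
  field_simp

theorem curvEndo (hε : ε ≠ 0) (hc : c ≠ 0) (hV : IsOpen V) (h : IsRescalingOn ε c K G V)
    (i j k l : Fin (n + 1)) (x : Coord n) (hx : rescale ε x ∈ V) :
    curvEndo K i j k l x = weight ε i * weight ε j * weight ε k * (weight ε l)⁻¹ *
      curvEndo G i j k l (rescale ε x) := by
  have hΓ := h.christoffel hε hc hV
  have hpd : ∀ p a b d, pd p (NullLimit.christoffel K a b d) x =
      weight ε b * weight ε d * (weight ε a)⁻¹ * weight ε p *
        pd p (NullLimit.christoffel G a b d) (rescale ε x) :=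
    fun p a b d => pd_of_eq_comp_rescale hε hV (hΓ a b d) p x hx
  unfold NullLimit.curvEndo
  simp only [hpd, hΓ _ _ _ x hx]
  rw [mul_add, Finset.mul_sum]
  congr 1
  · ring
  · refine Finset.sum_congr rfl fun m _ => ?_
    have := weight_ne_zero hε m
    field_simp

/-- Lowering an index with the metric brings back one factor `c`. -/
theorem riem (hε : ε ≠ 0) (hc : c ≠ 0) (hV : IsOpen V) (h : IsRescalingOn ε c K G V)
    (i j k l : Fin (n + 1)) (x : Coord n) (hx : rescale ε x ∈ V) :
    riem K i j k l x = c * weight ε i * weight ε j * weight ε k * weight ε l *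
      riem G i j k l (rescale ε x) := by
  unfold NullLimit.riem
  simp only [h.curvEndo hε hc hV _ _ _ _ x hx, h x hx]
  rw [Finset.mul_sum]
  refine Finset.sum_congr rfl fun m _ => ?_
  have := weight_ne_zero hε m
  field_simp

/-- The trace pairs a weight with its inverse and needs no metric, so no `c` appears. This mismatch
with the metric is what makes the Einstein constant scale. -/
theorem ricci (hε : ε ≠ 0) (hc : c ≠ 0) (hV : IsOpen V) (h : IsRescalingOn ε c K G V)
    (j k : Fin (n + 1)) (x : Coord n) (hx : rescale ε x ∈ V) :
    ricci K j k x = weight ε j * weight ε k * ricci G j k (rescale ε x) := by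
  unfold NullLimit.ricci
  simp only [h.curvEndo hε hc hV _ _ _ _ x hx]
  rw [Finset.mul_sum]
  refine Finset.sum_congr rfl fun m _ => ?_
  have := weight_ne_zero hε m
  field_simp

theorem covRiem (hε : ε ≠ 0) (hc : c ≠ 0) (hV : IsOpen V) (h : IsRescalingOn ε c K G V)
    (p i j k l : Fin (n + 1)) (x : Coord n) (hx : rescale ε x ∈ V) :
    covRiem K p i j k l x =
      c * weight ε i * weight ε j * weight ε k * weight ε l * weight ε p *
        covRiem G p i j k l (rescale ε x) := by
  have hR := h.riem hε hc hV
  unfold NullLimit.covRiem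
  rw [pd_of_eq_comp_rescale hε hV (hR i j k l) p x hx]
  simp only [hR _ _ _ _ x hx, h.christoffel hε hc hV _ _ _ x hx]
  rw [mul_sub, Finset.mul_sum]
  congr 1
  refine Finset.sum_congr rfl fun m _ => ?_
  have := weight_ne_zero hε m
  field_simp

theorem covRicci (hε : ε ≠ 0) (hc : c ≠ 0) (hV : IsOpen V) (h : IsRescalingOn ε c K G V)
    (p i j : Fin (n + 1)) (x : Coord n) (hx : rescale ε x ∈ V) :
    covRicci K p i j x =
      weight ε i * weight ε j * weight ε p * covRicci G p i j (rescale ε x) := by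
  have hR := h.ricci hε hc hV
  unfold NullLimit.covRicci
  rw [pd_of_eq_comp_rescale hε hV (hR i j) p x hx]
  simp only [hR _ _ x hx, h.christoffel hε hc hV _ _ _ x hx]
  rw [mul_sub, Finset.mul_sum]
  congr 1
  refine Finset.sum_congr rfl fun m _ => ?_
  have := weight_ne_zero hε m
  field_simp

end IsRescalingOn

end Scaling

/-! ### Lorentzian matrices -/

namespace IsLorentzianMatrix

variable {A : Matrix (Fin (n + 1)) (Fin (n + 1)) ℝ}

theorem det_ne_zero (hA : IsLorentzianMatrix A) : A.det ≠ 0 := by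
  obtain ⟨P, -, h⟩ := hA
  intro h0
  have h1 := congrArg Matrix.det h
  rw [Matrix.det_mul, Matrix.det_mul, h0, mul_zero, zero_mul, minkowski, Matrix.det_diagonal] at h1
  exact Finset.prod_ne_zero_iff.2 (fun i _ => by split_ifs <;> norm_num) h1.symm

/-- If `P` brings `A` to Minkowski form, then `Q⁻¹ * P` does so for `Qᵀ A Q`. -/
theorem of_congr {B Q : Matrix (Fin (n + 1)) (Fin (n + 1)) ℝ} (hA : IsLorentzianMatrix A)
    (hQ : IsUnit Q.det) (h : Q.transpose * A * Q = B) : IsLorentzianMatrix B := by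
  obtain ⟨P, hP, hPA⟩ := hA
  refine ⟨Q⁻¹ * P, ?_, ?_⟩
  · rw [Matrix.det_mul]
    exact (Matrix.isUnit_nonsing_inv_det Q hQ).mul hP
  · have h1 : Q * Q⁻¹ = 1 := Matrix.mul_nonsing_inv Q hQ
    have h2 : (Q⁻¹).transpose * Q.transpose = 1 := by
      rw [← Matrix.transpose_mul, h1, Matrix.transpose_one]
    rw [← h, ← hPA, Matrix.transpose_mul]
    calc P.transpose * (Q⁻¹).transpose * (Q.transpose * A * Q) * (Q⁻¹ * P)
        = P.transpose * ((Q⁻¹).transpose * Q.transpose) * A * (Q * Q⁻¹) * P := by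
          simp only [mul_assoc]
      _ = P.transpose * A * P := by rw [h1, h2, mul_one, mul_one]

theorem symm (hA : IsLorentzianMatrix A) (i j : Fin (n + 1)) : A i j = A j i := by
  obtain ⟨P, hP, h⟩ := hA
  have h1 : P * P⁻¹ = 1 := Matrix.mul_nonsing_inv P hP
  have h2 : (P⁻¹).transpose * P.transpose = 1 := by
    rw [← Matrix.transpose_mul, h1, Matrix.transpose_one]
  have h3 : A = (P⁻¹).transpose * minkowski n * P⁻¹ := by
    calc A = ((P⁻¹).transpose * P.transpose) * A * (P * P⁻¹) := by rw [h1, h2, mul_one, one_mul]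
      _ = _ := by rw [← h]; simp only [mul_assoc]
  have h4 : A.transpose = A := by
    rw [h3]
    simp [Matrix.transpose_mul, minkowski, mul_assoc]
  exact congrFun (congrFun h4 j) i

end IsLorentzianMatrix

/-- Replacing each basis vector `eⱼ` by `eⱼ - vⱼ e₀` clears the unwanted entries of row and column
`1`: `e₀` is null and pairs only with `e₁`, so no other entry changes. -/
theorem isLorentzianMatrix_planeWave (hn : 1 ≤ n) {g : MetricField n} {x : Coord n}
    (hg : IsLorentzianMatrix (g (axisPoint x)))
    (hnull : ∀ j, g (axisPoint x) 0 j = if j = 1 then 1 else 0) :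
    IsLorentzianMatrix (planeWave g x) := by
  -- This is where `1 ≤ n` enters: in `Fin 1` the indices `0` and `1` coincide.
  have h10 : (1 : Fin (n + 1)) ≠ 0 := by
    obtain ⟨m, rfl⟩ := Nat.exists_eq_add_of_le' hn
    simp
  set A := g (axisPoint x) with hA
  have hcol : ∀ i, A i 0 = if i = 1 then 1 else 0 := fun i => by rw [hg.symm, hnull]
  -- The `(1,1)` entry is hit by both the row and the column correction, hence the half; `v 0 = 0`
  -- preserves the entry `A 0 1 = 1` and makes `N` square to zero, so that `1 + N` inverts `1 - N`.
  let v : Fin (n + 1) → ℝ := fun j => if j = 0 then 0 else if j = 1 then A 1 1 / 2 else A 1 j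
  let N : Matrix (Fin (n + 1)) (Fin (n + 1)) ℝ := Matrix.of fun i j => if i = 0 then v j else 0
  have hNN : N * N = 0 := by
    ext i j
    simp [Matrix.mul_apply, N, v]
  have hunit : IsUnit (1 - N).det := by
    refine (Matrix.isUnit_iff_isUnit_det _).1 (IsUnit.of_mul_eq_one (1 + N) ?_)
    rw [sub_mul, mul_add, mul_add, hNN]
    simp
  refine hg.of_congr (Q := 1 - N) hunit ?_
  have hAN : ∀ i j, (A * N) i j = if i = 1 then v j else 0 := fun i j => by
    simp [Matrix.mul_apply, N, hcol]
  have hNA : ∀ i j, (N.transpose * A) i j = if j = 1 then v i else 0 := fun i j => by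
    simp [Matrix.mul_apply, N, hnull]
  have hNAN : N.transpose * (A * N) = 0 := by
    ext i j
    simp [Matrix.mul_apply, hAN, N, h10]
  have hexp : (1 - N).transpose * A * (1 - N) = A - A * N - N.transpose * A := by
    rw [← add_zero (A - A * N - N.transpose * A), ← hNAN, Matrix.transpose_sub,
      Matrix.transpose_one]
    noncomm_ring
  ext i j
  rw [hexp, Matrix.sub_apply, Matrix.sub_apply, hAN, hNA]
  have hs := hg.symm
  by_cases hi0 : i = 0
  · subst hi0
    by_cases hj1 : j = 1 <;> simp [planeWave, hnull, v, h10.symm, hj1]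
  by_cases hj0 : j = 0
  · subst hj0
    by_cases hi1 : i = 1 <;> simp [planeWave, hcol, v, h10.symm, hi1, hi0]
  by_cases hi1 : i = 1
  · subst hi1
    by_cases hj1 : j = 1
    · subst hj1
      simp [planeWave, v, h10]
      ring
    · simp [planeWave, v, h10, hj0, hj1]
  · by_cases hj1 : j = 1
    · subst hj1
      simp [planeWave, v, h10, hi0, hi1, hs i 1]
    · simp [planeWave, hi0, hi1, hj0, hj1, hA]

/-! ### The family of rescaled metrics -/

/-- The family `ε⁻² (φ_ε⁻¹)* g`, extended to `ε = 0` by the plane wave limit. -/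
def planeWaveFamily (g : MetricField n) (ε : ℝ) : MetricField n := fun x i j =>
  if (i = 0 ∧ j = 1) ∨ (i = 1 ∧ j = 0) then 1
  else if i = 0 ∨ j = 0 then 0
  else (if i = 1 then ε else 1) * (if j = 1 then ε else 1) * g (rescale ε x) i j

/-- The family `e^{2f}` times the rescaled metrics. -/
def conformalFamily (f : Coord n → ℝ) (g : MetricField n) (ε : ℝ) : MetricField n := fun x =>
  Real.exp (2 * f (rescale ε x)) • planeWaveFamily g ε x

theorem planeWaveFamily_zero (g : MetricField n) : planeWaveFamily g 0 = planeWave g := by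
  funext x i j
  unfold planeWaveFamily planeWave
  rw [rescale_zero]
  by_cases hi1 : i = 1 <;> by_cases hj1 : j = 1 <;> simp [hi1, hj1]

/-- For nonzero indices, `ε⁻²` times the two weights leaves one factor `ε` for each index equal to
`1`. The first row and column are settled by the null form and symmetry. -/
theorem isRescalingOn_planeWaveFamily (hn : 1 ≤ n) {g : MetricField n} {U : Set (Coord n)}
    (hg : IsLorentzianMetricOn g U) (hnull : IsNullFormOn g U) {ε : ℝ} (hε : ε ≠ 0) :
    IsRescalingOn ε (ε ^ 2)⁻¹ (planeWaveFamily g ε) g U := by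
  have h10 : (1 : Fin (n + 1)) ≠ 0 := by
    obtain ⟨m, rfl⟩ := Nat.exists_eq_add_of_le' hn
    simp
  intro x hx i j
  have hcol : ∀ i, g (rescale ε x) i 0 = if i = 1 then 1 else 0 := fun i => by
    rw [(hg.lorentzian _ hx).symm, hnull _ hx]
  unfold planeWaveFamily
  by_cases hi0 : i = 0
  · subst hi0
    rw [hnull _ hx]
    by_cases hj1 : j = 1
    · subst hj1; simp [weight, h10, hε]
    · simp [hj1, h10.symm]
  by_cases hj0 : j = 0
  · subst hj0
    rw [hcol]
    by_cases hi1 : i = 1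
    · subst hi1; simp [weight, h10, hε]
    · simp [hi1, h10.symm]
  simp only [weight, hi0, hj0, false_and, and_false, or_self, if_false]
  split_ifs <;> field_simp

theorem planeWave_isLorentzianMetricOn (hn : 1 ≤ n) {g : MetricField n} {U : Set (Coord n)}
    (hg : IsLorentzianMetricOn g U) (hnull : IsNullFormOn g U) :
    IsLorentzianMetricOn (planeWave g) (planeWaveDomain U) where
  smooth i j := by
    unfold planeWave
    split_ifs
    · exact contDiffOn_const
    · exact contDiffOn_const
    · exact (hg.smooth i j).comp contDiff_axisPoint.contDiffOn fun x hx => hx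
  lorentzian x hx := isLorentzianMatrix_planeWave hn (hg.lorentzian _ hx) (hnull _ hx)

theorem isOpen_rescale_preimage {V : Set (Coord n)} (hV : IsOpen V) :
    IsOpen {q : ℝ × Coord n | rescale q.1 q.2 ∈ V} :=
  hV.preimage contDiff_rescale.continuous

/-! ### Curvature conditions in the limit `ε → 0` -/

section Families

variable {g : MetricField n} {U V : Set (Coord n)} {f : Coord n → ℝ}

theorem smoothFamilyOn_planeWaveFamily (hg : ∀ i j, ContDiffOn ℝ ∞ (fun x => g x i j) V)
    (i j : Fin (n + 1)) : SmoothFamilyOn (fun ε x => planeWaveFamily g ε x i j)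
      {q : ℝ × Coord n | rescale q.1 q.2 ∈ V} := by
  have hlin : ∀ k : Fin (n + 1), SmoothFamilyOn (fun ε (_ : Coord n) => if k = 1 then ε else 1)
      {q : ℝ × Coord n | rescale q.1 q.2 ∈ V} := fun k => by
    by_cases hk : k = 1
    · simpa [hk, SmoothFamilyOn] using contDiff_fst.contDiffOn
    · simpa [hk] using SmoothFamilyOn.const _
  unfold planeWaveFamily
  split_ifs
  all_goals first
    | exact .const _
    | skip
  all_goals
    refine ContDiffOn.mul ?_ ((hg i j).comp contDiff_rescale.contDiffOn fun q hq => hq)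
    have := (hlin i).mul (hlin j)
    simp_all [SmoothFamilyOn]

theorem smoothFamilyOn_conformalFamily (hg : ∀ i j, ContDiffOn ℝ ∞ (fun x => g x i j) V)
    (hf : ContDiffOn ℝ ∞ f V) (i j : Fin (n + 1)) :
    SmoothFamilyOn (fun ε x => conformalFamily f g ε x i j)
      {q : ℝ × Coord n | rescale q.1 q.2 ∈ V} :=
  SmoothFamilyOn.mul (F := fun ε x => Real.exp (2 * f (rescale ε x)))
    (((contDiffOn_const (c := (2 : ℝ))).mul
      (hf.comp contDiff_rescale.contDiffOn fun _ hq => hq)).exp)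
    (smoothFamilyOn_planeWaveFamily hg i j)

/-- For `ε ≠ 0` nondegeneracy comes from `g`; at `ε = 0` it comes from the Lorentzian signature of
the limit. -/
theorem det_planeWaveFamily_ne_zero (hn : 1 ≤ n) (hg : IsLorentzianMetricOn g U)
    (hnull : IsNullFormOn g U) {q : ℝ × Coord n} (hq : rescale q.1 q.2 ∈ U) :
    (planeWaveFamily g q.1 q.2).det ≠ 0 := by
  obtain ⟨ε, x⟩ := q
  by_cases hε : ε = 0
  · subst hε
    rw [planeWaveFamily_zero]
    rw [rescale_zero] at hq
    exact ((planeWave_isLorentzianMetricOn hn hg hnull).lorentzian x hq).det_ne_zero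
  · exact (isRescalingOn_planeWaveFamily hn hg hnull hε).det_ne_zero hε (by simp [hε]) hq
      (hg.lorentzian _ hq).det_ne_zero

theorem det_conformalFamily_ne_zero (hn : 1 ≤ n) (hg : IsLorentzianMetricOn g U)
    (hnull : IsNullFormOn g U) {q : ℝ × Coord n} (hq : rescale q.1 q.2 ∈ U) :
    (conformalFamily f g q.1 q.2).det ≠ 0 := by
  rw [conformalFamily, Matrix.det_smul]
  exact mul_ne_zero (pow_ne_zero _ (Real.exp_ne_zero _))
    (det_planeWaveFamily_ne_zero hn hg hnull hq)

theorem planeWave_isRicciFlatOn (hn : 1 ≤ n) (hU : IsOpen U) (hg : IsLorentzianMetricOn g U)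
    (hnull : IsNullFormOn g U) {lam : ℝ} (h : HasEinsteinConstantOn g lam U) :
    IsRicciFlatOn (planeWave g) (planeWaveDomain U) := by
  intro x hx i j
  have hW := isOpen_rescale_preimage hU
  have hK := smoothFamilyOn_planeWaveFamily hg.smooth
  have hsq : SmoothFamilyOn (fun ε (_ : Coord n) => ε ^ 2 * lam)
      {q : ℝ × Coord n | rescale q.1 q.2 ∈ U} :=
    ((contDiff_fst.pow 2).mul contDiff_const).contDiffOn
  -- The family taken to the limit is `Ric(K_ε) - ε² λ K_ε`; its second term vanishes at `ε = 0`.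
  have h0 := SmoothFamilyOn.eq_zero_of_ne hW
    ((smoothFamilyOn_ricci hW hK (fun _ => det_planeWaveFamily_ne_zero hn hg hnull) i j).sub
      (hsq.mul (hK i j))) (x := x) (by simpa [rescale_zero, planeWaveDomain] using hx) fun ε hε hq => by
        have hs := isRescalingOn_planeWaveFamily hn hg hnull hε
        rw [hs.ricci hε (by simp [hε]) hU i j x hq, h _ hq, hs x hq]
        field_simp
        ring
  simpa [planeWaveFamily_zero] using h0

theorem planeWave_isLocallySymmetricOn (hn : 1 ≤ n) (hU : IsOpen U)
    (hg : IsLorentzianMetricOn g U) (hnull : IsNullFormOn g U) (h : IsLocallySymmetricOn g U) :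
    IsLocallySymmetricOn (planeWave g) (planeWaveDomain U) := by
  intro x hx p i j k l
  have hW := isOpen_rescale_preimage hU
  have hK := smoothFamilyOn_planeWaveFamily hg.smooth
  rw [← planeWaveFamily_zero]
  refine SmoothFamilyOn.eq_zero_of_ne (F := fun ε => covRiem (planeWaveFamily g ε) p i j k l) hW
    (smoothFamilyOn_covRiem hW hK (fun _ => det_planeWaveFamily_ne_zero hn hg hnull) p i j k l)
    (by simpa [rescale_zero, planeWaveDomain] using hx) fun ε hε hq => ?_
  rw [(isRescalingOn_planeWaveFamily hn hg hnull hε).covRiem hε (by simp [hε]) hU _ _ _ _ _ x hq,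
    h _ hq, mul_zero]

theorem planeWave_hasParallelRicciOn (hn : 1 ≤ n) (hU : IsOpen U)
    (hg : IsLorentzianMetricOn g U) (hnull : IsNullFormOn g U) (h : HasParallelRicciOn g U) :
    HasParallelRicciOn (planeWave g) (planeWaveDomain U) := by
  intro x hx p i j
  have hW := isOpen_rescale_preimage hU
  have hK := smoothFamilyOn_planeWaveFamily hg.smooth
  rw [← planeWaveFamily_zero]
  refine SmoothFamilyOn.eq_zero_of_ne (F := fun ε => covRicci (planeWaveFamily g ε) p i j) hW
    (smoothFamilyOn_covRicci hW hK (fun _ => det_planeWaveFamily_ne_zero hn hg hnull) p i j)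
    (by simpa [rescale_zero, planeWaveDomain] using hx) fun ε hε hq => ?_
  rw [(isRescalingOn_planeWaveFamily hn hg hnull hε).covRicci hε (by simp [hε]) hU _ _ _ x hq,
    h _ hq, mul_zero]

theorem planeWave_isFlatOn_conformal (hn : 1 ≤ n) (hV : IsOpen V)
    (hg : IsLorentzianMetricOn g V) (hnull : IsNullFormOn g V) (hf : ContDiffOn ℝ ∞ f V)
    (h : IsFlatOn (fun x => Real.exp (2 * f x) • g x) V) :
    IsFlatOn (fun x => Real.exp (2 * f (axisPoint x)) • planeWave g x) (planeWaveDomain V) := by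
  intro x hx i j k l
  have hW := isOpen_rescale_preimage hV
  have h0 : (fun x => Real.exp (2 * f (axisPoint x)) • planeWave g x) = conformalFamily f g 0 := by
    funext y
    rw [conformalFamily, planeWaveFamily_zero, rescale_zero]
  rw [h0]
  refine SmoothFamilyOn.eq_zero_of_ne (F := fun ε => riem (conformalFamily f g ε) i j k l) hW
    (smoothFamilyOn_riem hW (smoothFamilyOn_conformalFamily hg.smooth hf)
      (fun _ => det_conformalFamily_ne_zero hn hg hnull) i j k l)
    (by simpa [rescale_zero, planeWaveDomain] using hx) fun ε hε hq => ?_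
  -- Because `f` is evaluated at the dilated point, the conformal metric is rescaled as a whole,
  -- with the same constant.
  have hs : IsRescalingOn ε (ε ^ 2)⁻¹ (conformalFamily f g ε)
      (fun x => Real.exp (2 * f x) • g x) V := fun y hy a b => by
    have hab := isRescalingOn_planeWaveFamily hn hg hnull hε y hy a b
    simp only [conformalFamily, Matrix.smul_apply, smul_eq_mul, hab]
    ring
  rw [hs.riem hε (by simp [hε]) hV _ _ _ _ x hq, h _ hq, mul_zero]

theorem planeWave_isLocallyConformallyFlatOn (hn : 1 ≤ n) (hg : IsLorentzianMetricOn g U)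
    (hnull : IsNullFormOn g U) (h : IsLocallyConformallyFlatOn g U) :
    IsLocallyConformallyFlatOn (planeWave g) (planeWaveDomain U) := by
  intro p hp
  obtain ⟨V, hV, hpV, hVU, f, hf, hflat⟩ := h (axisPoint p) hp
  -- The flat neighborhood is the full cylinder over `V`, with a conformal factor depending on `x⁰`
  -- alone.
  exact ⟨planeWaveDomain V, hV.preimage contDiff_axisPoint.continuous, hpV, fun x hx => hVU hx,
    fun x => f (axisPoint x), hf.comp contDiff_axisPoint.contDiffOn fun x hx => hx,
    planeWave_isFlatOn_conformal hn hV
      ⟨fun i j => (hg.smooth i j).mono hVU, fun x hx => hg.lorentzian x (hVU hx)⟩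
      (fun x hx => hnull x (hVU hx)) hf hflat⟩

end Families

end NullLimit

end

theorem mainTheorem6 (n : ℕ) (hn : 1 ≤ n) (U : Set (NullLimit.Coord n)) (hU : IsOpen U)
    (g : NullLimit.MetricField n) (hg : NullLimit.IsLorentzianMetricOn g U)
    (hnull : NullLimit.IsNullFormOn g U) :
    NullLimit.IsLorentzianMetricOn (NullLimit.planeWave g) (NullLimit.planeWaveDomain U) ∧
    (∀ lam : ℝ, NullLimit.HasEinsteinConstantOn g lam U →
      NullLimit.IsRicciFlatOn (NullLimit.planeWave g) (NullLimit.planeWaveDomain U)) ∧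
    (NullLimit.IsLocallyConformallyFlatOn g U →
      NullLimit.IsLocallyConformallyFlatOn (NullLimit.planeWave g)
        (NullLimit.planeWaveDomain U)) ∧
    (NullLimit.IsLocallySymmetricOn g U →
      NullLimit.IsLocallySymmetricOn (NullLimit.planeWave g) (NullLimit.planeWaveDomain U)) ∧
    (NullLimit.HasParallelRicciOn g U →
      NullLimit.HasParallelRicciOn (NullLimit.planeWave g) (NullLimit.planeWaveDomain U)) := by
  exact ⟨NullLimit.planeWave_isLorentzianMetricOn hn hg hnull,
    fun _ => NullLimit.planeWave_isRicciFlatOn hn hU hg hnull,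
    NullLimit.planeWave_isLocallyConformallyFlatOn hn hg hnull,
    NullLimit.planeWave_isLocallySymmetricOn hn hU hg hnull,
    NullLimit.planeWave_hasParallelRicciOn hn hU hg hnull⟩
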